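/- Let $n\ge 1$ and let $A,B,C\in\mathbb{R}^{n\times n}$, where $A$ and $C$ are symmetric and positive definite and $B$ is arbitrary. Define the Gaussian kernel $\kappa_G\colon\mathbb{R}^{2n}\to\mathbb{C}$ by $$\kappa_G(x,y)=\exp\left\{-(x-y)^{\top}A(x-y)-i(x-y)^{\top}B(x+y)-(x+y)^{\top}C(x+y)\right\}\qquad(x,y\in\mathbb{R}^n).$$ Let $P\colon\mathbb{R}^{2n}\to\mathbb{C}$ be a non-zero polynomial in $2n$ variables with complex coefficients, and let $\kappa_{PG}(x,y)=P(x,y)\,\kappa_G(x,y)$. For a kernel $\kappa\in L^2(\mathbb{R}^{2n})$ let $\widehat{\kappa}\colon L^2(\mathbb{R}^n)\to L^2(\mathbb{R}^n)$ be the integral operator $(\widehat{\kappa}f)(x)=\int_{\mathbb{R}^n}\kappa(x,y)f(y)\,\mathrm{d}y$ on complex-valued functions, and call $\widehat{\kappa}$ positive semidefinite if for every $f\in L^2(\mathbb{R}^n)$ the number $\langle\widehat{\kappa}f,f\rangle=\int_{\mathbb{R}^n}(\widehat{\kappa}f)(x)\,\overline{f(x)}\,\mathrm{d}x$ is real and non-negative.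 If $\widehat{\kappa}_G$ is not positive semidefinite, then $\widehat{\kappa}_{PG}$ is not positive semidefinite either. -/

import Mathlib

open MeasureTheory
open scoped ComplexOrder

noncomputable section

namespace PolyGauss

/-- The Gaussian kernel
`κ_G(x, y) = exp (-(x-y)ᵀ A (x-y) - i (x-y)ᵀ B (x+y) - (x+y)ᵀ C (x+y))` on `ℝⁿ × ℝⁿ`. -/
def gaussianKernel {n : ℕ} (A B C : Matrix (Fin n) (Fin n) ℝ) (x y : Fin n → ℝ) : ℂ :=
  Complex.exp
    (-(((x - y) ⬝ᵥ A.mulVec (x - y) : ℝ) : ℂ)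
      - Complex.I * (((x - y) ⬝ᵥ B.mulVec (x + y) : ℝ) : ℂ)
      - (((x + y) ⬝ᵥ C.mulVec (x + y) : ℝ) : ℂ))

/-- The value at a real point `(x, y)` of a complex polynomial in `2n` variables; the left summand
of the index type carries the variables `x₁, …, xₙ`, the right one `y₁, …, yₙ`. -/
def polyEval {n : ℕ} (P : MvPolynomial (Fin n ⊕ Fin n) ℂ) (x y : Fin n → ℝ) : ℂ :=
  MvPolynomial.eval (Sum.elim (fun i => (x i : ℂ)) (fun i => (y i : ℂ))) P

/-- The polynomial Gaussian kernel `P(x, y) κ_G(x, y)`. -/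
def polyGaussianKernel {n : ℕ} (P : MvPolynomial (Fin n ⊕ Fin n) ℂ)
    (A B C : Matrix (Fin n) (Fin n) ℝ) (x y : Fin n → ℝ) : ℂ :=
  polyEval P x y * gaussianKernel A B C x y

/-- The integral operator with kernel `κ`, applied to `f`: `x ↦ ∫ κ(x, y) f(y) dy`. -/
def integralOp {n : ℕ} (κ : (Fin n → ℝ) → (Fin n → ℝ) → ℂ) (f : (Fin n → ℝ) → ℂ) :
    (Fin n → ℝ) → ℂ :=
  fun x => ∫ y, κ x y * f y

/-- Positive semidefiniteness of the integral operator of `κ`: for all (complex-valued)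
`f ∈ L²(ℝⁿ)` the number `⟨κ̂ f, f⟩ = ∫ (κ̂ f)(x) (f x)^* dx` is real and nonnegative (the order
on `ℂ` is the one for which `0 ≤ z` means that `z` is real and nonnegative).
This is meant for square-integrable kernels, for which `κ̂ f` is again in `L²(ℝⁿ)`, so that all the
integrals converge. Only the Lebesgue measure on `Fin n → ℝ` is used, never its norm. -/
def OpPosSemidef {n : ℕ} (κ : (Fin n → ℝ) → (Fin n → ℝ) → ℂ) : Prop :=
  ∀ f : (Fin n → ℝ) → ℂ, MemLp f 2 (volume : Measure (Fin n → ℝ)) →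
    0 ≤ ∫ x, integralOp κ f x * (starRingEnd ℂ) (f x)

end PolyGauss

end

/-!
Put `H = 2(A - C) - i(B - Bᵀ)`, a Hermitian matrix. Expanding the exponent and using the symmetry of
`A` and `C` gives `κ_G(x, y) = g(x)^* g(y) exp (xᵀ H y)` for real `x`, `y`, where `g` is a Gaussian
(`gaussianKernel_eq`). The theorem follows from two implications.

If `H` is positive semidefinite, then so is the operator of `κ_G`
(`opPosSemidef_gaussianKernel`). Indeed `H = Lᴴ L`, so `xᵀ H y` is a sum of products
`φ_i(x)^* φ_i(y)`; its powers are sums of the same kind, and the exponential series may be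
integrated term by term.

If the operator of `P κ_G` is positive semidefinite and `P ≠ 0`, then `H` is positive semidefinite
(`posSemidef_crossForm`). The kernel `P κ_G` extends to an entire function `F` on `ℂⁿ × ℂⁿ` that
decays like a Gaussian in real directions. Testing positivity on narrow Gaussians centred at
*complex* points, and shifting the contour of integration to these points
(`GaussDecay.integral_add_eq`), shows that `F(z̄, w)` is a positive definite kernel on `ℂⁿ`
(`OpPosSemidef.sum_nonneg`). After removing the factors in one variable, Cauchy–Schwarz for two
points reads
`|P(z̄, w) exp (z̄ᵀ H w)|² ≤ P(z̄, z) exp (z̄ᵀ H z) · P(w̄, w) exp (w̄ᵀ H w)`.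
If `c̄ᵀ H c < 0`, put `w = b + t c` and let the real number `t` tend to infinity. The right-hand side
decays like `exp (-ε t²)` up to factors of exponential growth, so the polynomial
`t ↦ P(z̄, b + t c)` tends to `0` and therefore vanishes identically; in particular `P(z̄, b) = 0`.
As `z` and `b` are arbitrary, `P = 0` (`eq_zero_of_norm_sq_twistedKernel_le`).
-/

namespace PolyGauss

open Matrix Filter Topology

variable {ι : Type*} [Fintype ι]

/-! ### Growth and Gaussian decay of entire functions on complex space -/

/-- The inclusion `ℝ^ι → ℂ^ι`. -/
abbrev complexify (p : ι → ℝ) : ι → ℂ := fun i => (p i : ℂ)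

lemma norm_complexify_sq_le (p : ι → ℝ) : ‖complexify p‖ ^ 2 ≤ p ⬝ᵥ p := by
  have h0 : 0 ≤ p ⬝ᵥ p := Finset.sum_nonneg fun i _ => mul_self_nonneg _
  have h : ‖complexify p‖ ≤ √(p ⬝ᵥ p) := by
    refine (pi_norm_le_iff_of_nonneg (Real.sqrt_nonneg _)).2 fun i => ?_
    rw [Complex.norm_real, Real.norm_eq_abs]
    refine Real.abs_le_sqrt ?_
    rw [sq]
    exact Finset.single_le_sum (f := fun j => p j * p j)
      (fun j _ => mul_self_nonneg _) (Finset.mem_univ i)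
  calc ‖complexify p‖ ^ 2 ≤ √(p ⬝ᵥ p) ^ 2 := by gcongr
    _ = _ := Real.sq_sqrt h0

lemma exists_norm_dotProduct_mulVec_le {κ : Type*} [Fintype κ] (Q : Matrix ι κ ℂ) :
    ∃ M : ℝ, 0 ≤ M ∧ ∀ v w, ‖v ⬝ᵥ Q *ᵥ w‖ ≤ M * ‖v‖ * ‖w‖ := by
  refine ⟨∑ i, ∑ j, ‖Q i j‖, by positivity, fun v w => ?_⟩
  simp only [dotProduct, mulVec, Finset.mul_sum, Finset.sum_mul]
  refine (norm_sum_le _ _).trans (Finset.sum_le_sum fun i _ => ?_)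
  refine (norm_sum_le _ _).trans (Finset.sum_le_sum fun j _ => ?_)
  rw [norm_mul, norm_mul]
  have h1 := norm_le_pi_norm v i
  have h2 := norm_le_pi_norm w j
  calc ‖v i‖ * (‖Q i j‖ * ‖w j‖) = ‖Q i j‖ * (‖v i‖ * ‖w j‖) := by ring
    _ ≤ ‖Q i j‖ * (‖v‖ * ‖w‖) := by gcongr
    _ = _ := by ring

/-- A polynomial grows at most exponentially. The crude exponential bound is enough here, since it
is always multiplied by a Gaussian. -/
lemma exists_norm_eval_le {σ : Type*} [Fintype σ] (P : MvPolynomial σ ℂ) :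
    ∃ K m : ℝ, 0 ≤ K ∧ 0 ≤ m ∧ ∀ v, ‖MvPolynomial.eval v P‖ ≤ K * Real.exp (m * ‖v‖) := by
  induction P using MvPolynomial.induction_on with
  | C a => exact ⟨‖a‖, 0, norm_nonneg _, le_rfl, fun v => by simp⟩
  | add p q hp hq =>
    obtain ⟨K, m, hK, hm, h⟩ := hp
    obtain ⟨K', m', hK', hm', h'⟩ := hq
    refine ⟨K + K', m + m', by positivity, by positivity, fun v => ?_⟩
    rw [map_add, add_mul]
    refine (norm_add_le _ _).trans (add_le_add ((h v).trans ?_) ((h' v).trans ?_))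
    · have : 0 ≤ m' * ‖v‖ := by positivity
      gcongr; linarith
    · have : 0 ≤ m * ‖v‖ := by positivity
      gcongr; linarith
  | mul_X p i hp =>
    obtain ⟨K, m, hK, hm, h⟩ := hp
    refine ⟨K, m + 1, hK, by positivity, fun v => ?_⟩
    rw [map_mul, MvPolynomial.eval_X, norm_mul, add_mul, Real.exp_add, ← mul_assoc]
    have : ‖v i‖ ≤ Real.exp (1 * ‖v‖) := by
      have := Real.add_one_le_exp ‖v‖
      have := norm_le_pi_norm v i
      rw [one_mul]; linarith
    exact mul_le_mul (h v) this (norm_nonneg _) (by positivity)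

lemma differentiable_eval {σ : Type*} [Fintype σ] (P : MvPolynomial σ ℂ) :
    Differentiable ℂ fun v : σ → ℂ => MvPolynomial.eval v P := by
  induction P using MvPolynomial.induction_on with
  | C a => simp
  | add p q hp hq =>
    simp only [map_add]
    exact hp.add hq
  | mul_X p i hp =>
    simp only [map_mul, MvPolynomial.eval_X]
    exact hp.mul (differentiable_apply i)

lemma differentiable_dotProduct_mulVec (Q : Matrix ι ι ℂ) :
    Differentiable ℂ fun v : ι → ℂ => v ⬝ᵥ Q *ᵥ v := by
  simp only [dotProduct, mulVec]
  fun_prop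

/-- Gaussian decay along real directions, locally uniformly in complex translations: for bounded
`q ∈ ℂ^ι` the function `p ↦ F (p + q)` on `ℝ^ι` is bounded by a fixed multiple of a fixed
Gaussian. -/
def GaussDecay (F : (ι → ℂ) → ℂ) : Prop :=
  ∀ R : ℝ, ∃ K δ : ℝ, 0 < δ ∧ ∀ (p : ι → ℝ) (q : ι → ℂ), ‖q‖ ≤ R →
    ‖F (complexify p + q)‖ ≤ K * Real.exp (-δ * (p ⬝ᵥ p))

lemma integrable_exp_neg_dotProduct_self {δ : ℝ} (hδ : 0 < δ) :
    Integrable fun p : ι → ℝ => Real.exp (-δ * (p ⬝ᵥ p)) := by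
  have := (GaussianFourier.integrable_cexp_neg_mul_sum_add (ι := ι) (b := (δ : ℂ))
    (by simpa using hδ) 0).norm
  refine this.congr (ae_of_all _ fun p => ?_)
  simp only [Complex.norm_exp]
  congr 1
  simp [dotProduct, sq]

lemma GaussDecay.integrable {F : (ι → ℂ) → ℂ} (hF : GaussDecay F) (hc : Continuous F) (q : ι → ℂ) :
    Integrable fun p : ι → ℝ => F (complexify p + q) := by
  obtain ⟨K, δ, hδ, h⟩ := hF ‖q‖
  refine ((integrable_exp_neg_dotProduct_self hδ).const_mul K).mono' ?_
    (ae_of_all _ fun p => h p q le_rfl)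
  refine Continuous.aestronglyMeasurable ?_
  fun_prop

/-! ### Shifting real integrals into the complex domain -/

lemma tendsto_ofReal_one_div_nhdsNE_zero :
    Tendsto (fun k : ℕ => ((1 / ((k : ℝ) + 1) : ℝ) : ℂ)) atTop (𝓝[≠] 0) := by
  refine tendsto_nhdsWithin_iff.2 ⟨?_, Eventually.of_forall fun k => ?_⟩
  · have := (Complex.continuous_ofReal.tendsto 0).comp
      (tendsto_one_div_add_atTop_nhds_zero_nat (𝕜 := ℝ))
    simpa [Function.comp_def] using this
  · have : (1 / ((k : ℝ) + 1) : ℝ) ≠ 0 := by positivity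
    simpa only [Set.mem_compl_iff, Set.mem_singleton_iff, Complex.ofReal_eq_zero] using this

/-- An integral of entire functions with locally uniform integrable bounds is entire: Cauchy's
estimate turns the bound on the integrand into one on its derivative in the parameter. -/
lemma differentiable_integral_of_dominated {α : Type*} [MeasurableSpace α] {μ : Measure α}
    {f : ℂ → α → ℂ} (hm : ∀ s, AEStronglyMeasurable (f s) μ) (hd : ∀ a, Differentiable ℂ (f · a))
    (hb : ∀ R : ℝ, ∃ g : α → ℝ, Integrable g μ ∧ ∀ s a, ‖s‖ ≤ R → ‖f s a‖ ≤ g a) :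
    Differentiable ℂ fun s => ∫ a, f s a ∂μ := by
  intro s₀
  obtain ⟨g, hg, hfg⟩ := hb (‖s₀‖ + 2)
  have hder : ∀ a, ∀ s ∈ Metric.ball s₀ 1, ‖deriv (f · a) s‖ ≤ g a := by
    intro a s hs
    have := Complex.norm_deriv_le_of_forall_mem_sphere_norm_le (c := s) (R := 1) (C := g a)
      one_pos (hd a).diffContOnCl (fun z hz => hfg z a ?_)
    · simpa using this
    · have h1 : ‖z - s‖ = 1 := by simpa [dist_eq_norm] using hz
      have h2 : ‖s - s₀‖ < 1 := by simpa [dist_eq_norm] using hs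
      calc ‖z‖ = ‖s₀ + (s - s₀) + (z - s)‖ := by congr 1; ring
        _ ≤ ‖s₀‖ + ‖s - s₀‖ + ‖z - s‖ := norm_add₃_le
        _ ≤ _ := by linarith
  have hmeas : AEStronglyMeasurable (fun a => deriv (f · a) s₀) μ := by
    -- the derivative is the limit of difference quotients along a sequence
    refine aestronglyMeasurable_of_tendsto_ae (u := atTop)
      (f := fun (k : ℕ) a => ((1 / ((k : ℝ) + 1) : ℝ) : ℂ)⁻¹ •
        (f (s₀ + ((1 / ((k : ℝ) + 1) : ℝ) : ℂ)) a - f s₀ a)) ?_ ?_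
    · intro k
      exact ((hm _).sub (hm _)).const_smul (_ : ℂ)
    · refine ae_of_all _ fun a => ?_
      have := ((hd a) s₀).hasDerivAt.tendsto_slope_zero
      exact this.comp tendsto_ofReal_one_div_nhdsNE_zero
  exact (hasDerivAt_integral_of_dominated_loc_of_deriv_le (Metric.ball_mem_nhds s₀ one_pos)
    (Eventually.of_forall hm) (hg.mono' (hm s₀) (ae_of_all _ fun a => hfg s₀ a (by linarith)))
    hmeas (ae_of_all _ hder) hg
    (ae_of_all _ fun a s _ => (hd a s).hasDerivAt)).2.differentiableAt

/-- The contour of integration may be shifted into the complex domain. Real shifts leave the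
integral unchanged because Lebesgue measure is translation invariant; the integral is an entire
function of the shift along a line, so the identity theorem covers imaginary shifts. -/
lemma GaussDecay.integral_add_eq {F : (ι → ℂ) → ℂ} (hF : GaussDecay F) (hd : Differentiable ℂ F)
    (q : ι → ℂ) : ∫ p : ι → ℝ, F (complexify p + q) = ∫ p : ι → ℝ, F (complexify p) := by
  have key : ∀ b : ι → ℝ, ∀ s : ℂ,
      ∫ p : ι → ℝ, F (complexify p + s • complexify b) = ∫ p : ι → ℝ, F (complexify p) := by
    intro b
    have hreal : ∀ s : ℝ, ∫ p : ι → ℝ, F (complexify p + (s : ℂ) • complexify b)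
        = ∫ p : ι → ℝ, F (complexify p) := by
      intro s
      rw [← integral_add_right_eq_self (fun p : ι → ℝ => F (complexify p)) (s • b)]
      congr 1; ext p; congr 1; ext i; simp [complexify]
    have hg : Differentiable ℂ fun s : ℂ => ∫ p : ι → ℝ, F (complexify p + s • complexify b) := by
      refine differentiable_integral_of_dominated (fun s => ?_) (fun p => ?_) (fun R => ?_)
      · exact (hF.integrable hd.continuous _).aestronglyMeasurable
      · exact hd.comp (by fun_prop)
      · obtain ⟨K, δ, hδ, h⟩ := hF (R * ‖complexify b‖)
        refine ⟨_, (integrable_exp_neg_dotProduct_self hδ).const_mul K, fun s p hs => h p _ ?_⟩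
        rw [norm_smul]
        gcongr
    have hfreq : ∃ᶠ s : ℂ in 𝓝[≠] 0,
        ∫ p : ι → ℝ, F (complexify p + s • complexify b) = ∫ p : ι → ℝ, F (complexify p) := by
      exact tendsto_ofReal_one_div_nhdsNE_zero.frequently (Frequently.of_forall fun k => hreal _)
    intro s
    exact congrFun (AnalyticOnNhd.eq_of_frequently_eq (hg.differentiableOn.analyticOnNhd isOpen_univ)
      (analyticOnNhd_const) hfreq) s
  have hq : ∀ p : ι → ℝ, complexify p + q =
      complexify (p + fun i => (q i).re) + Complex.I • complexify (fun i => (q i).im) := by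
    intro p; ext i
    simp only [complexify, Pi.add_apply, Pi.smul_apply, smul_eq_mul, Complex.ofReal_add]
    conv_lhs => rw [← Complex.re_add_im (q i)]
    ring
  simp_rw [hq]
  rw [integral_add_right_eq_self (fun p : ι → ℝ =>
    F (complexify p + Complex.I • complexify (fun i => (q i).im)))]
  exact key _ _

/-! ### Evaluation at complex points by narrow Gaussians -/

/-- A complex-centred Gaussian weight is bounded on real points, although its modulus may exceed
one. -/
lemma norm_cexp_neg_mul_dotProduct_self_le {N : ℝ} (hN : 0 ≤ N) (p : ι → ℝ) (q : ι → ℂ) :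
    ‖Complex.exp (-(N : ℂ) * ((complexify p + q) ⬝ᵥ (complexify p + q)))‖
      ≤ Real.exp (N * (Fintype.card ι * ‖q‖ ^ 2)) := by
  rw [Complex.norm_exp, Real.exp_le_exp, ← Complex.ofReal_neg, Complex.re_ofReal_mul, neg_mul,
    ← mul_neg]
  refine mul_le_mul_of_nonneg_left ?_ hN
  have : ∀ i ∈ Finset.univ, -((complexify p + q) i * (complexify p + q) i).re ≤ ‖q‖ ^ 2 := by
    intro i _
    have h1 : |(q i).im| ≤ ‖q‖ := (Complex.abs_im_le_norm _).trans (norm_le_pi_norm q i)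
    have h2 : (q i).im ^ 2 ≤ ‖q‖ ^ 2 := by rw [← sq_abs]; gcongr
    simp only [complexify, Pi.add_apply, Complex.mul_re, Complex.add_re, Complex.add_im,
      Complex.ofReal_re, Complex.ofReal_im]
    nlinarith [mul_self_nonneg (p i + (q i).re)]
  rw [dotProduct, Complex.re_sum, ← Finset.sum_neg_distrib]
  refine (Finset.sum_le_sum this).trans ?_
  simp

lemma GaussDecay.mul_cexp {F : (ι → ℂ) → ℂ} (hF : GaussDecay F) {N : ℝ} (hN : 0 ≤ N)
    (q : ι → ℂ) :
    GaussDecay fun v => F v * Complex.exp (-(N : ℂ) * ((v - q) ⬝ᵥ (v - q))) := by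
  intro R
  obtain ⟨K, δ, hδ, h⟩ := hF R
  refine ⟨K * Real.exp (N * (Fintype.card ι * (R + ‖q‖) ^ 2)), δ, hδ, fun p r hr => ?_⟩
  rw [norm_mul, mul_right_comm]
  have h1 := norm_cexp_neg_mul_dotProduct_self_le hN p (r - q)
  rw [← add_sub_assoc] at h1
  have h2 : ‖r - q‖ ≤ R + ‖q‖ := (norm_sub_le _ _).trans (by gcongr)
  refine mul_le_mul (h p r hr) (h1.trans ?_) (norm_nonneg _) ((norm_nonneg _).trans (h p r hr))
  gcongr

lemma differentiable_mul_cexp {F : (ι → ℂ) → ℂ} (hF : Differentiable ℂ F) (N : ℝ) (q : ι → ℂ) :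
    Differentiable ℂ fun v => F v * Complex.exp (-(N : ℂ) * ((v - q) ⬝ᵥ (v - q))) := by
  simp only [dotProduct, Pi.sub_apply]
  fun_prop

/-- Integration against a Gaussian of width `1 / M` centred at the complex point `q`, after shifting
the contour to `q` and rescaling. -/
lemma GaussDecay.integral_mul_cexp {F : (ι → ℂ) → ℂ} (hF : GaussDecay F)
    (hd : Differentiable ℂ F) {M : ℝ} (hM : 0 < M) (q : ι → ℂ) :
    (M : ℂ) ^ Fintype.card ι * ∫ p : ι → ℝ, F (complexify p) *
        Complex.exp (-((M ^ 2 : ℝ) : ℂ) * ((complexify p - q) ⬝ᵥ (complexify p - q)))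
      = ∫ p : ι → ℝ, F (complexify (M⁻¹ • p) + q) * (Real.exp (-(1 : ℝ) * (p ⬝ᵥ p)) : ℂ) := by
  rw [← (hF.mul_cexp (sq_nonneg M) q).integral_add_eq (differentiable_mul_cexp hd _ q) q]
  have := Measure.integral_comp_inv_smul_of_nonneg volume (fun p : ι → ℝ =>
    F (complexify p + q) * Complex.exp (-((M ^ 2 : ℝ) : ℂ) *
      ((complexify p + q - q) ⬝ᵥ (complexify p + q - q)))) hM.le
  rw [Module.finrank_pi, Complex.real_smul] at this
  rw [← Complex.ofReal_pow M (Fintype.card ι), ← this]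
  congr 1; ext p
  congr 1
  rw [Complex.ofReal_exp]
  congr 1
  have hM' : (M : ℂ) ≠ 0 := by exact_mod_cast hM.ne'
  simp only [dotProduct, complexify, add_sub_cancel_right, Pi.smul_apply, smul_eq_mul,
    Complex.ofReal_mul, Complex.ofReal_sum, Complex.ofReal_neg, Complex.ofReal_inv,
    Complex.ofReal_one, Complex.ofReal_pow, Finset.mul_sum]
  refine Finset.sum_congr rfl fun i _ => ?_
  field_simp

/-- As their width tends to zero, Gaussians centred at a complex point `q` act on `F` as a multiple
of the point evaluation at `q`. -/
lemma GaussDecay.tendsto_integral {F : (ι → ℂ) → ℂ} (hF : GaussDecay F) (hc : Continuous F)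
    (q : ι → ℂ) :
    Tendsto (fun k : ℕ => ∫ p : ι → ℝ, F (complexify (((k : ℝ) + 1)⁻¹ • p) + q) *
        (Real.exp (-(1 : ℝ) * (p ⬝ᵥ p)) : ℂ)) atTop
      (𝓝 (F q * ((∫ p : ι → ℝ, Real.exp (-(1 : ℝ) * (p ⬝ᵥ p)) : ℝ) : ℂ))) := by
  obtain ⟨K, δ, hδ, h⟩ := hF ‖q‖
  have hlim : F q * ((∫ p : ι → ℝ, Real.exp (-(1 : ℝ) * (p ⬝ᵥ p)) : ℝ) : ℂ)
      = ∫ p : ι → ℝ, F q * (Real.exp (-(1 : ℝ) * (p ⬝ᵥ p)) : ℂ) := by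
    rw [integral_const_mul, integral_complex_ofReal]
  rw [hlim]
  refine tendsto_integral_of_dominated_convergence
    (fun p => |K| * Real.exp (-(1 : ℝ) * (p ⬝ᵥ p))) (fun k => ?_)
    ((integrable_exp_neg_dotProduct_self one_pos).const_mul _) (fun k => ae_of_all _ fun p => ?_)
    (ae_of_all _ fun p => ?_)
  · refine Continuous.aestronglyMeasurable ?_
    simp only [dotProduct]
    fun_prop
  · rw [norm_mul, Complex.norm_real, Real.norm_eq_abs, Real.abs_exp]
    gcongr
    refine (h _ q le_rfl).trans ?_
    have h1 : Real.exp (-δ * ((((k : ℝ) + 1)⁻¹ • p) ⬝ᵥ (((k : ℝ) + 1)⁻¹ • p))) ≤ 1 := by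
      rw [Real.exp_le_one_iff, neg_mul, neg_nonpos]
      exact mul_nonneg hδ.le (Finset.sum_nonneg fun i _ => mul_self_nonneg _)
    calc K * _ ≤ |K| * Real.exp (-δ * ((((k : ℝ) + 1)⁻¹ • p) ⬝ᵥ (((k : ℝ) + 1)⁻¹ • p))) := by
          gcongr; exact le_abs_self K
      _ ≤ |K| * 1 := by gcongr
      _ = |K| := mul_one _
  · refine Tendsto.mul_const _ ?_
    have h0 : Tendsto (fun k : ℕ => ((k : ℝ) + 1)⁻¹) atTop (𝓝 0) := by
      simpa using tendsto_one_div_add_atTop_nhds_zero_nat (𝕜 := ℝ)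
    have h1 : Continuous fun s : ℝ => F (complexify (s • p) + q) := by fun_prop
    have h2 : complexify ((0 : ℝ) • p) + q = q := by ext i; simp [complexify]
    have := (h1.tendsto 0).comp h0
    rwa [h2] at this

lemma integral_sumElim {n : ℕ} {T : (Fin n ⊕ Fin n → ℝ) → ℂ} (hT : Integrable T) :
    ∫ x : Fin n → ℝ, ∫ y : Fin n → ℝ, T (Sum.elim x y) = ∫ p, T p := by
  have hmp := (volume_measurePreserving_sumPiEquivProdPi (fun _ : Fin n ⊕ Fin n => ℝ)).symm
  have hsymm : ∀ z : (Fin n → ℝ) × (Fin n → ℝ),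
      (MeasurableEquiv.sumPiEquivProdPi (fun _ : Fin n ⊕ Fin n => ℝ)).symm z
        = Sum.elim z.1 z.2 := by
    rintro ⟨x, y⟩
    ext i; cases i <;> rfl
  have hi := (hmp.integrable_comp_emb (MeasurableEquiv.measurableEmbedding _)).2 hT
  have he := hmp.integral_comp (MeasurableEquiv.measurableEmbedding _) T
  rw [← he]
  simp only [Function.comp_def, hsymm] at hi ⊢
  exact (integral_prod _ hi).symm

lemma memLp_two_cexp {M : ℝ} (hM : 0 < M) (w : ι → ℂ) :
    MemLp (fun y : ι → ℝ => Complex.exp (-((M ^ 2 : ℝ) : ℂ) *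
      ((complexify y - w) ⬝ᵥ (complexify y - w)))) 2 volume := by
  rw [memLp_two_iff_integrable_sq_norm]
  · have hb : 0 < ((2 * M ^ 2 : ℝ) : ℂ).re := by rw [Complex.ofReal_re]; positivity
    have := ((GaussianFourier.integrable_cexp_neg_mul_sum_add hb
      (fun i => 4 * (M : ℂ) ^ 2 * w i)).const_mul
        (Complex.exp (-(2 * M ^ 2) * ∑ i, w i ^ 2))).norm
    refine this.congr (ae_of_all _ fun y => ?_)
    simp only [← Complex.exp_add, ← norm_pow, ← Complex.exp_nat_mul]
    congr 2
    simp only [dotProduct, complexify, Pi.sub_apply, Finset.mul_sum, ← Finset.sum_add_distrib]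
    refine Finset.sum_congr rfl fun i _ => ?_
    push_cast
    ring
  · refine Continuous.aestronglyMeasurable ?_
    simp only [dotProduct]
    fun_prop

/-! ### Positivity of the entire extension of a kernel -/

/-- If a positive semidefinite kernel has an entire extension `F` with Gaussian decay, then
`(z, w) ↦ F (z̄, w)` is a positive definite kernel in the complex points `z`, `w`. The test functions
are combinations of Gaussians that concentrate at the complex points `w k`. -/
theorem OpPosSemidef.sum_nonneg {n : ℕ} {F : (Fin n ⊕ Fin n → ℂ) → ℂ} (hF : GaussDecay F)
    (hd : Differentiable ℂ F) (h : OpPosSemidef fun x y => F (complexify (Sum.elim x y)))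
    {κ : Type*} [Fintype κ] (c : κ → ℂ) (w : κ → Fin n → ℂ) :
    0 ≤ ∑ j, ∑ k, star (c j) * c k * F (Sum.elim (star (w j)) (w k)) := by
  -- the Gaussian weight concentrated at the complex point `w k`
  let g : ℝ → (Fin n → ℂ) → (Fin n → ℝ) → ℂ := fun M z y =>
    Complex.exp (-((M ^ 2 : ℝ) : ℂ) * ((complexify y - z) ⬝ᵥ (complexify y - z)))
  let q : κ → κ → Fin n ⊕ Fin n → ℂ := fun j k => Sum.elim (star (w j)) (w k)
  let I : ℝ → κ → κ → ℂ := fun M j k => ∫ p : Fin n ⊕ Fin n → ℝ, F (complexify p) *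
        Complex.exp (-((M ^ 2 : ℝ) : ℂ) * ((complexify p - q j k) ⬝ᵥ (complexify p - q j k)))
  have hpos : ∀ M : ℝ, 0 < M → 0 ≤ ∑ j, ∑ k, star (c j) * c k * I M j k := by
    intro M hM
    have hf : MemLp (fun y => ∑ k, c k * g M (w k) y) 2 volume :=
      memLp_finsetSum _ fun k _ => (memLp_two_cexp hM (w k)).const_mul (c k)
    have h0 := h _ hf
    let T : (Fin n ⊕ Fin n → ℝ) → ℂ := fun p => ∑ j, ∑ k, star (c j) * c k * (F (complexify p) *
        Complex.exp (-((M ^ 2 : ℝ) : ℂ) * ((complexify p - q j k) ⬝ᵥ (complexify p - q j k))))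
    have hint : ∀ j k, Integrable fun p : Fin n ⊕ Fin n → ℝ => F (complexify p) *
        Complex.exp (-((M ^ 2 : ℝ) : ℂ) * ((complexify p - q j k) ⬝ᵥ (complexify p - q j k))) := by
      intro j k
      simpa using (hF.mul_cexp (sq_nonneg M) (q j k)).integrable
        (differentiable_mul_cexp hd (M ^ 2) (q j k)).continuous 0
    have hT : Integrable T :=
      integrable_finsetSum _ fun j _ => integrable_finsetSum _ fun k _ => (hint j k).const_mul _
    have hTI : ∫ p, T p = ∑ j, ∑ k, star (c j) * c k * I M j k := by
      rw [integral_finsetSum _ fun j _ =>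
        integrable_finsetSum _ fun k _ => (hint j k).const_mul _]
      refine Finset.sum_congr rfl fun j _ => ?_
      rw [integral_finsetSum _ fun k _ => (hint j k).const_mul _]
      exact Finset.sum_congr rfl fun k _ => integral_const_mul _ _
    rw [← hTI, ← integral_sumElim hT]
    convert! h0 using 3 with x
    rw [integralOp, ← integral_mul_const]
    congr 1; ext y
    simp only [T, map_sum, Finset.mul_sum, Finset.sum_mul, map_mul]
    refine Finset.sum_congr rfl fun j _ => Finset.sum_congr rfl fun k _ => ?_
    have hs : complexify (Sum.elim x y) - q j k
        = Sum.elim (complexify x - star (w j)) (complexify y - w k) := by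
      ext i; cases i <;> rfl
    have hconj : (starRingEnd ℂ) (g M (w j) x) = Complex.exp (-((M ^ 2 : ℝ) : ℂ) *
        ((complexify x - star (w j)) ⬝ᵥ (complexify x - star (w j)))) := by
      simp only [g, ← Complex.exp_conj, map_mul, map_neg, Complex.conj_ofReal, dotProduct, map_sum,
        complexify, Pi.sub_apply, map_sub, Pi.star_apply, Complex.star_def]
    rw [hs, sumElim_dotProduct_sumElim, mul_add, Complex.exp_add, hconj]
    simp only [g, Complex.star_def]
    ring
  set G : ℝ := ∫ p : Fin n ⊕ Fin n → ℝ, Real.exp (-(1 : ℝ) * (p ⬝ᵥ p)) with hG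
  have hGpos : 0 < G := integral_exp_pos (integrable_exp_neg_dotProduct_self one_pos)
  have hlim : Tendsto (fun m : ℕ => ∑ j, ∑ k, star (c j) * c k *
      ((((m : ℝ) + 1 : ℝ) : ℂ) ^ Fintype.card (Fin n ⊕ Fin n) * I ((m : ℝ) + 1) j k)) atTop
      (𝓝 (∑ j, ∑ k, star (c j) * c k * (F (q j k) * (G : ℂ)))) := by
    refine tendsto_finsetSum _ fun j _ => tendsto_finsetSum _ fun k _ => Tendsto.const_mul _ ?_
    refine (hF.tendsto_integral hd.continuous (q j k)).congr fun m => ?_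
    exact (hF.integral_mul_cexp hd (M := (m : ℝ) + 1) (by positivity) (q j k)).symm
  have hnonneg : 0 ≤ ∑ j, ∑ k, star (c j) * c k * (F (q j k) * (G : ℂ)) := by
    refine ge_of_tendsto' hlim fun m => ?_
    have h1 := hpos ((m : ℝ) + 1) (by positivity)
    have h2 : (0 : ℂ) ≤ (((m : ℝ) + 1 : ℝ) : ℂ) ^ Fintype.card (Fin n ⊕ Fin n) := by
      rw [← Complex.ofReal_pow]
      exact_mod_cast (by positivity : (0 : ℝ) ≤ ((m : ℝ) + 1) ^ Fintype.card (Fin n ⊕ Fin n))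
    refine (mul_nonneg h2 h1).trans_eq ?_
    simp only [Finset.mul_sum]
    exact Finset.sum_congr rfl fun j _ => Finset.sum_congr rfl fun k _ => by ring
  have hGinv : (0 : ℂ) ≤ ((G⁻¹ : ℝ) : ℂ) := by exact_mod_cast (inv_pos.2 hGpos).le
  refine (mul_nonneg hGinv hnonneg).trans_eq ?_
  have hG0 : (G : ℂ) ≠ 0 := by exact_mod_cast hGpos.ne'
  simp only [Finset.mul_sum]
  refine Finset.sum_congr rfl fun j _ => Finset.sum_congr rfl fun k _ => ?_
  push_cast
  field_simp
  rfl

/-- The Cauchy–Schwarz inequality for a sesquilinear form on `ℂ²` that takes nonnegative values on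
the diagonal; hermitian symmetry is not assumed, since it follows. -/
lemma sq_norm_le_of_nonneg {a b o₁ o₂ : ℂ}
    (h : ∀ s t : ℂ, 0 ≤ star s * s * a + star s * t * o₁ + star t * s * o₂ + star t * t * b) :
    ‖o₁‖ ^ 2 ≤ ‖a‖ * ‖b‖ := by
  have ha := h 1 0
  have hb := h 0 1
  have h1 := h 1 1
  have h2 := h 1 Complex.I
  simp only [Complex.le_def, Complex.star_def] at ha hb h1 h2
  simp at ha hb h1 h2
  -- positivity on the coordinate vectors and their sums makes the form Hermitian
  have ho : o₂ = star o₁ := by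
    apply Complex.ext
    · simp; linarith [h2.2]
    · simp; linarith [h1.2]
  -- the value at `(1, -x * star o₁)` is a quadratic polynomial in `x`
  have hq : ∀ x : ℝ, 0 ≤ (‖o₁‖ ^ 2 * b.re) * (x * x) + (-2 * ‖o₁‖ ^ 2) * x + a.re := by
    intro x
    have h3 := (Complex.le_def.1 (h 1 (-x * star o₁))).1
    refine h3.trans_eq ?_
    rw [ho, Complex.sq_norm, Complex.normSq_apply]
    simp [Complex.mul_re, Complex.mul_im]
    ring
  refine le_trans ?_ (mul_le_mul (Complex.re_le_norm a) (Complex.re_le_norm b) hb.1 (norm_nonneg a))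
  have hdisc := discrim_le_zero hq
  rw [discrim] at hdisc
  rcases (sq_nonneg ‖o₁‖).eq_or_lt with h0 | h0
  · rw [← h0]; exact mul_nonneg ha.1 hb.1
  · have h4 : ‖o₁‖ ^ 2 * (‖o₁‖ ^ 2 - a.re * b.re) ≤ 0 := by nlinarith
    by_contra hcon
    push Not at hcon
    nlinarith [mul_pos h0 (sub_pos.2 hcon)]

/-! ### Polynomial times Gaussian: decay, and vanishing along a negative direction -/

lemma exists_forall_mul_le_of_posDef {M : Matrix ι ι ℝ} (hM : M.PosDef) :
    ∃ δ : ℝ, 0 < δ ∧ ∀ p : ι → ℝ, δ * (p ⬝ᵥ p) ≤ p ⬝ᵥ M *ᵥ p := by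
  cases isEmpty_or_nonempty ι
  · exact ⟨1, one_pos, fun p => by simp [dotProduct]⟩
  have hcont : Continuous fun p : ι → ℝ => p ⬝ᵥ M *ᵥ p := by
    simp only [dotProduct, mulVec]; fun_prop
  obtain ⟨p₀, hp₀, hmin⟩ := (isCompact_sphere (0 : ι → ℝ) 1).exists_isMinOn
    (NormedSpace.sphere_nonempty.2 zero_le_one) hcont.continuousOn
  have hp₀' : p₀ ≠ 0 := by
    rintro rfl
    simp at hp₀
  have hpos : 0 < p₀ ⬝ᵥ M *ᵥ p₀ := by simpa using hM.dotProduct_mulVec_pos hp₀'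
  have hcard : (0 : ℝ) < Fintype.card ι := by exact_mod_cast Fintype.card_pos
  refine ⟨(p₀ ⬝ᵥ M *ᵥ p₀) / Fintype.card ι, div_pos hpos hcard, fun p => ?_⟩
  rcases eq_or_ne p 0 with rfl | hp
  · simp
  have hn : 0 < ‖p‖ := norm_pos_iff.2 hp
  have h1 : p₀ ⬝ᵥ M *ᵥ p₀ ≤ (‖p‖⁻¹ • p) ⬝ᵥ M *ᵥ (‖p‖⁻¹ • p) :=
    hmin (show ‖p‖⁻¹ • p ∈ Metric.sphere (0 : ι → ℝ) 1 by
      simp [norm_smul, hn.ne'])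
  rw [mulVec_smul, smul_dotProduct, dotProduct_smul, smul_eq_mul, smul_eq_mul] at h1
  have h2 : p ⬝ᵥ p ≤ Fintype.card ι * ‖p‖ ^ 2 := by
    have : ∀ i ∈ Finset.univ, p i * p i ≤ ‖p‖ ^ 2 := by
      intro i _
      have := norm_le_pi_norm p i
      rw [← sq, ← sq_abs, ← Real.norm_eq_abs]
      gcongr
    refine (Finset.sum_le_sum this).trans ?_
    simp
  calc _ ≤ (p₀ ⬝ᵥ M *ᵥ p₀) / Fintype.card ι * (Fintype.card ι * ‖p‖ ^ 2) := by gcongr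
    _ = (p₀ ⬝ᵥ M *ᵥ p₀) * ‖p‖ ^ 2 := by field_simp
    _ ≤ (‖p‖⁻¹ * (‖p‖⁻¹ * (p ⬝ᵥ M *ᵥ p))) * ‖p‖ ^ 2 := by gcongr
    _ = _ := by field_simp

lemma gaussDecay_eval_mul_cexp (P : MvPolynomial ι ℂ) {Q : Matrix ι ι ℂ} {δ : ℝ} (hδ : 0 < δ)
    (hQ : ∀ p : ι → ℝ, δ * (p ⬝ᵥ p) ≤ (complexify p ⬝ᵥ Q *ᵥ complexify p).re) :
    GaussDecay fun v => MvPolynomial.eval v P * Complex.exp (-(v ⬝ᵥ Q *ᵥ v)) := by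
  intro R
  obtain ⟨K, m, hK, hm, hP⟩ := exists_norm_eval_le P
  obtain ⟨M, hM, hB⟩ := exists_norm_dotProduct_mulVec_le Q
  -- the terms linear in `p` have slope at most `L`; half of the Gaussian absorbs them
  set L : ℝ := m + 2 * M * |R| with hL
  refine ⟨K * Real.exp (m * |R| + M * |R| ^ 2 + L ^ 2 / (2 * δ)), δ / 2, by positivity,
    fun p q hq => ?_⟩
  have hq' : ‖q‖ ≤ |R| := hq.trans (le_abs_self R)
  set a := ‖complexify p‖ with ha
  have ha0 : 0 ≤ a := norm_nonneg _
  have hexp : ((complexify p + q) ⬝ᵥ Q *ᵥ (complexify p + q)).re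
      ≥ δ * (p ⬝ᵥ p) - 2 * M * |R| * a - M * |R| ^ 2 := by
    have e1 := (Complex.abs_re_le_norm _).trans (hB (complexify p) q)
    have e2 := (Complex.abs_re_le_norm _).trans (hB q (complexify p))
    have e3 := (Complex.abs_re_le_norm _).trans (hB q q)
    have e4 := hQ p
    simp only [mulVec_add, dotProduct_add, add_dotProduct, Complex.add_re]
    have f1 : M * a * ‖q‖ ≤ M * a * |R| := by gcongr
    have f2 : M * ‖q‖ * a ≤ M * |R| * a := by gcongr
    have f3 : M * ‖q‖ * ‖q‖ ≤ M * |R| * |R| := by gcongr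
    have g1 := (abs_le.1 e1).1
    have g2 := (abs_le.1 e2).1
    have g3 := (abs_le.1 e3).1
    nlinarith
  have hn : ‖complexify p + q‖ ≤ a + |R| := (norm_add_le _ _).trans (by gcongr)
  rw [norm_mul, Complex.norm_exp, Complex.neg_re, mul_assoc, ← Real.exp_add]
  calc _ ≤ (K * Real.exp (m * ‖complexify p + q‖)) *
        Real.exp (-((complexify p + q) ⬝ᵥ Q *ᵥ (complexify p + q)).re) := by
          gcongr; exact hP _
    _ = K * Real.exp (m * ‖complexify p + q‖ -
        ((complexify p + q) ⬝ᵥ Q *ᵥ (complexify p + q)).re) := by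
          rw [mul_assoc, ← Real.exp_add, sub_eq_add_neg]
    _ ≤ _ := by
      gcongr
      have h1 : m * ‖complexify p + q‖ ≤ m * (a + |R|) := by gcongr
      have h2 : L * a ≤ δ / 2 * a ^ 2 + L ^ 2 / (2 * δ) := by
        have : 0 ≤ (δ * a - L) ^ 2 / (2 * δ) := by positivity
        have e : (δ * a - L) ^ 2 / (2 * δ) = δ / 2 * a ^ 2 + L ^ 2 / (2 * δ) - L * a := by
          field_simp; ring
        linarith
      have h3 : δ / 2 * a ^ 2 ≤ δ / 2 * (p ⬝ᵥ p) := by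
        gcongr; exact norm_complexify_sq_le p
      rw [hL] at h2 ⊢
      nlinarith

/-- The restriction of a polynomial to a line is a polynomial in one variable. -/
lemma exists_polynomial_eval_line {σ : Type*} (P : MvPolynomial σ ℂ) (e d : σ → ℂ) :
    ∃ p : Polynomial ℂ, ∀ t : ℂ, p.eval t = MvPolynomial.eval (e + t • d) P := by
  induction P using MvPolynomial.induction_on with
  | C a => exact ⟨Polynomial.C a, fun t => by simp⟩
  | add p q hp hq =>
    obtain ⟨p', hp'⟩ := hp
    obtain ⟨q', hq'⟩ := hq
    exact ⟨p' + q', fun t => by simp [hp', hq']⟩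
  | mul_X p i hp =>
    obtain ⟨p', hp'⟩ := hp
    exact ⟨p' * (Polynomial.C (e i) + Polynomial.X * Polynomial.C (d i)), fun t => by
      simp [hp', mul_comm t]⟩

lemma polynomial_eq_zero_of_norm_sq_le {p : Polynomial ℂ} {K ε L : ℝ} (hε : 0 < ε)
    (h : ∀ t : ℝ, 0 ≤ t → ‖p.eval (t : ℂ)‖ ^ 2 ≤ K * Real.exp (-ε * t ^ 2 + L * t)) : p = 0 := by
  have hexp : Tendsto (fun t : ℝ => -ε * t ^ 2 + L * t) atTop atBot := by
    have h1 : Tendsto (fun t : ℝ => t * (-ε * t + L)) atTop atBot :=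
      tendsto_id.atTop_mul_atBot₀
        (tendsto_atBot_add_const_right _ _ (tendsto_id.const_mul_atTop_of_neg (neg_neg_of_pos hε)))
    refine h1.congr fun t => by ring
  have hlim : Tendsto (fun t : ℝ => ‖p.eval (t : ℂ)‖ ^ 2) atTop (𝓝 0) := by
    refine tendsto_of_tendsto_of_tendsto_of_le_of_le' tendsto_const_nhds
      (by simpa using (Real.tendsto_exp_atBot.comp hexp).const_mul K)
      (Eventually.of_forall fun t => by positivity) ?_
    filter_upwards [eventually_ge_atTop 0] with t ht
    simpa using h t ht
  rcases lt_or_ge 0 p.degree with hdeg | hdeg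
  · have h1 : Tendsto (fun t : ℝ => ‖p.eval (t : ℂ)‖) atTop atTop :=
      p.tendsto_norm_atTop hdeg (by simpa using tendsto_abs_atTop_atTop)
    exact absurd hlim (((tendsto_pow_atTop two_ne_zero).comp h1).not_tendsto
      (disjoint_nhds_atTop 0).symm)
  · rw [Polynomial.eq_C_of_degree_le_zero hdeg] at hlim ⊢
    simp only [Polynomial.eval_C] at hlim
    have := tendsto_nhds_unique hlim tendsto_const_nhds
    have h0 : p.coeff 0 = 0 := by simpa using this.symm
    rw [h0, map_zero]

/-- The kernel `P(z̄, w) exp (z̄ᵀ H w)` in complex points `z` and `w`. Up to a factor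
`g(z)^* g(w)`, this is the entire extension of the polynomial Gaussian kernel, evaluated at
`(z̄, w)`. -/
noncomputable def twistedKernel {n : ℕ} (P : MvPolynomial (Fin n ⊕ Fin n) ℂ)
    (H : Matrix (Fin n) (Fin n) ℂ)
    (z w : Fin n → ℂ) : ℂ :=
  MvPolynomial.eval (Sum.elim (star z) w) P * Complex.exp (star z ⬝ᵥ H *ᵥ w)

/-- If `H` is negative in some direction `c`, then a kernel `P(z̄, w) exp (z̄ᵀ H w)` that satisfies the
Cauchy–Schwarz inequality is zero. Along `w = b + t c` the diagonal value `N(w, w)` decays like a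
Gaussian in `t`, whereas `|exp (z̄ᵀ H w)|` decays at most exponentially; hence the polynomial
`t ↦ P(z̄, b + t c)` tends to `0`, is zero, and at `t = 0` gives `P(z̄, b) = 0`. -/
lemma eq_zero_of_norm_sq_twistedKernel_le {n : ℕ} {P : MvPolynomial (Fin n ⊕ Fin n) ℂ}
    {H : Matrix (Fin n) (Fin n) ℂ} {c : Fin n → ℂ} (hc : (star c ⬝ᵥ H *ᵥ c).re < 0)
    (h : ∀ z w, ‖twistedKernel P H z w‖ ^ 2
      ≤ ‖twistedKernel P H z z‖ * ‖twistedKernel P H w w‖) : P = 0 := by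
  obtain ⟨K, m, hK, hm, hP⟩ := exists_norm_eval_le P
  refine MvPolynomial.funext fun v => ?_
  rw [map_zero]
  set z : Fin n → ℂ := star (v ∘ Sum.inl) with hz
  set b : Fin n → ℂ := v ∘ Sum.inr with hb
  obtain ⟨p, hp⟩ := exists_polynomial_eval_line P (Sum.elim (star z) b) (Sum.elim (0 : Fin n → ℂ) c)
  have hline : ∀ t : ℂ, Sum.elim (star z) b + t • Sum.elim (0 : Fin n → ℂ) c
      = Sum.elim (star z) (b + t • c) := by
    intro t; ext i; cases i <;> simp
  have hv : Sum.elim (star z) b = v := by ext i; cases i <;> simp [hz, hb]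
  suffices p = 0 by
    have h0 := hp 0
    rw [this, zero_smul, add_zero, hv, Polynomial.eval_zero] at h0
    exact h0.symm
  set α := ‖twistedKernel P H z z‖
  -- exponents of the bounds for the factors, as polynomials in `t`
  set ε := -(star c ⬝ᵥ H *ᵥ c).re with hε
  set β := (star c ⬝ᵥ H *ᵥ b).re + (star b ⬝ᵥ H *ᵥ c).re with hβ
  set γ := (star b ⬝ᵥ H *ᵥ b).re with hγ
  set β' := (star z ⬝ᵥ H *ᵥ c).re with hβ'
  set γ' := (star z ⬝ᵥ H *ᵥ b).re with hγ'
  refine polynomial_eq_zero_of_norm_sq_le (K := α * (K * Real.exp (m * ‖b‖ + γ - 2 * γ')))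
    (ε := ε) (L := m * ‖c‖ + β - 2 * β') (by linarith) fun t ht => ?_
  have hw := h z (b + (t : ℂ) • c)
  have hN : ‖twistedKernel P H z (b + (t : ℂ) • c)‖
      = ‖p.eval (t : ℂ)‖ * Real.exp (γ' + t * β') := by
    rw [twistedKernel, norm_mul, hp, hline, Complex.norm_exp]
    congr 2
    simp [mulVec_add, mulVec_smul, hγ', hβ']
  have hD : ‖twistedKernel P H (b + (t : ℂ) • c) (b + (t : ℂ) • c)‖
      ≤ K * Real.exp (m * (‖b‖ + t * ‖c‖)) * Real.exp (γ + t * β - t ^ 2 * ε) := by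
    rw [twistedKernel, norm_mul, Complex.norm_exp]
    have h1 : ‖b + (t : ℂ) • c‖ ≤ ‖b‖ + t * ‖c‖ := by
      refine (norm_add_le _ _).trans ?_
      rw [norm_smul, Complex.norm_real, Real.norm_of_nonneg ht]
    have h2 : ‖(Sum.elim (star (b + (t : ℂ) • c)) (b + (t : ℂ) • c) : Fin n ⊕ Fin n → ℂ)‖
        ≤ ‖b‖ + t * ‖c‖ := by
      refine (pi_norm_le_iff_of_nonneg (by positivity)).2 fun i => ?_
      cases i with
      | inl i =>
        rw [Sum.elim_inl, Pi.star_apply, norm_star]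
        exact (norm_le_pi_norm _ i).trans h1
      | inr i => exact (norm_le_pi_norm _ i).trans h1
    refine mul_le_mul ((hP _).trans (by gcongr)) (Real.exp_le_exp.2 (le_of_eq ?_))
      (Real.exp_pos _).le (by positivity)
    simp [mulVec_add, mulVec_smul, hγ, hβ, hε]
    ring
  rw [hN] at hw
  have hfin : ‖p.eval (t : ℂ)‖ ^ 2 * Real.exp (γ' + t * β') ^ 2
      ≤ α * (K * Real.exp (m * (‖b‖ + t * ‖c‖)) * Real.exp (γ + t * β - t ^ 2 * ε)) := by
    rw [← mul_pow]
    exact hw.trans (by gcongr)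
  have hE : 0 < Real.exp (γ' + t * β') ^ 2 := by positivity
  refine (le_div_iff₀ hE).2 hfin |>.trans_eq ?_
  rw [div_eq_iff hE.ne', ← Real.exp_nat_mul]
  simp only [mul_assoc, ← Real.exp_add]
  congr 3
  push_cast
  ring

/-! ### The Gaussian kernel and its mixed terms -/

lemma ofReal_dotProduct_mulVec {ι : Type*} [Fintype ι] (M : Matrix ι ι ℝ) (x y : ι → ℝ) :
    ((x ⬝ᵥ M *ᵥ y : ℝ) : ℂ) = complexify x ⬝ᵥ M.map Complex.ofReal *ᵥ complexify y := by
  simp [dotProduct, mulVec, complexify]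

/-- The matrix `A + C + iB` of the terms of the exponent that depend on `x` alone, up to sign. The
terms in `y` alone have the entrywise conjugate matrix. -/
noncomputable def diagonalForm {n : ℕ} (A B C : Matrix (Fin n) (Fin n) ℝ) :
    Matrix (Fin n) (Fin n) ℂ :=
  A.map Complex.ofReal + C.map Complex.ofReal + Complex.I • B.map Complex.ofReal

/-- The Hermitian matrix `2(A - C) - i(B - Bᵀ)` of the mixed terms of the exponent. The Gaussian
operator is positive semidefinite exactly when this matrix is. -/
noncomputable def crossForm {n : ℕ} (A B C : Matrix (Fin n) (Fin n) ℝ) :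
    Matrix (Fin n) (Fin n) ℂ :=
  (2 : ℂ) • (A.map Complex.ofReal - C.map Complex.ofReal)
    - Complex.I • (B.map Complex.ofReal - (B.map Complex.ofReal)ᵀ)

lemma dotProduct_transpose_mulVec {ι R : Type*} [Fintype ι] [CommRing R] (M : Matrix ι ι R)
    (x y : ι → R) : x ⬝ᵥ Mᵀ *ᵥ y = y ⬝ᵥ M *ᵥ x := by
  rw [dotProduct_mulVec, vecMul_transpose, dotProduct_comm]

section

variable {n : ℕ} {A B C : Matrix (Fin n) (Fin n) ℝ}

lemma isHermitian_crossForm (hA : A.PosDef) (hC : C.PosDef) : (crossForm A B C).IsHermitian := by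
  have hA' : Aᵀ = A := by simpa using hA.isHermitian.eq
  have hC' : Cᵀ = C := by simpa using hC.isHermitian.eq
  ext i j
  have h1 : A j i = A i j := congrFun (congrFun hA' i) j
  have h2 : C j i = C i j := congrFun (congrFun hC' i) j
  simp [crossForm, h1, h2]
  ring

lemma gaussianKernel_eq (hA : A.PosDef) (hC : C.PosDef) (x y : Fin n → ℝ) :
    gaussianKernel A B C x y = Complex.exp (-(complexify x ⬝ᵥ diagonalForm A B C *ᵥ complexify x)
      - complexify y ⬝ᵥ (diagonalForm A B C).map star *ᵥ complexify y
      + complexify x ⬝ᵥ crossForm A B C *ᵥ complexify y) := by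
  have hA' : (A.map Complex.ofReal)ᵀ = A.map Complex.ofReal := by
    rw [← transpose_map]; congr 1; simpa using hA.isHermitian.eq
  have hC' : (C.map Complex.ofReal)ᵀ = C.map Complex.ofReal := by
    rw [← transpose_map]; congr 1; simpa using hC.isHermitian.eq
  have hstar : (diagonalForm A B C).map star =
      A.map Complex.ofReal + C.map Complex.ofReal - Complex.I • B.map Complex.ofReal := by
    ext i j; simp [diagonalForm, sub_eq_add_neg]
  have hsub : complexify (x - y) = complexify x - complexify y := by ext; simp [complexify]
  have hadd : complexify (x + y) = complexify x + complexify y := by ext; simp [complexify]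
  have h1 := dotProduct_transpose_mulVec (A.map Complex.ofReal) (complexify x) (complexify y)
  have h2 := dotProduct_transpose_mulVec (C.map Complex.ofReal) (complexify x) (complexify y)
  rw [hA'] at h1
  rw [hC'] at h2
  rw [gaussianKernel, ofReal_dotProduct_mulVec, ofReal_dotProduct_mulVec, ofReal_dotProduct_mulVec,
    hstar, hsub, hadd]
  congr 1
  simp only [diagonalForm, crossForm, mulVec_add, mulVec_sub, add_mulVec, sub_mulVec, smul_mulVec,
    dotProduct_add, dotProduct_sub, add_dotProduct, sub_dotProduct, dotProduct_smul, smul_eq_mul,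
    dotProduct_transpose_mulVec]
  rw [h1, h2]
  ring

/-- A complex matrix whose quadratic form in `(x, y)` is minus the exponent of the Gaussian kernel.
It is not symmetric: the mixed terms all stand in the upper right block. -/
noncomputable def fullForm {n : ℕ} (A B C : Matrix (Fin n) (Fin n) ℝ) :
    Matrix (Fin n ⊕ Fin n) (Fin n ⊕ Fin n) ℂ :=
  fromBlocks (diagonalForm A B C) (-crossForm A B C) 0 ((diagonalForm A B C).map star)

lemma dotProduct_fullForm_mulVec (z w : Fin n → ℂ) :
    -(Sum.elim z w ⬝ᵥ fullForm A B C *ᵥ Sum.elim z w) = -(z ⬝ᵥ diagonalForm A B C *ᵥ z)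
      - w ⬝ᵥ (diagonalForm A B C).map star *ᵥ w + z ⬝ᵥ crossForm A B C *ᵥ w := by
  rw [fullForm, fromBlocks_mulVec, sumElim_dotProduct_sumElim]
  simp [dotProduct_add, neg_mulVec]
  ring

lemma polyGaussianKernel_eq (hA : A.PosDef) (hC : C.PosDef) (P : MvPolynomial (Fin n ⊕ Fin n) ℂ)
    (x y : Fin n → ℝ) :
    polyGaussianKernel P A B C x y = MvPolynomial.eval (complexify (Sum.elim x y)) P *
      Complex.exp (-(complexify (Sum.elim x y) ⬝ᵥ
        fullForm A B C *ᵥ complexify (Sum.elim x y))) := by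
  have : complexify (Sum.elim x y) = Sum.elim (complexify x) (complexify y) := by
    ext i; cases i <;> rfl
  rw [polyGaussianKernel, polyEval, gaussianKernel_eq hA hC, this, dotProduct_fullForm_mulVec]

/-- The real part of the form is `(x-y)ᵀ A (x-y) + (x+y)ᵀ C (x+y)`, which is positive definite. -/
lemma exists_forall_mul_le_re_fullForm (hA : A.PosDef) (hC : C.PosDef) :
    ∃ δ : ℝ, 0 < δ ∧ ∀ p : Fin n ⊕ Fin n → ℝ,
      δ * (p ⬝ᵥ p) ≤ (complexify p ⬝ᵥ fullForm A B C *ᵥ complexify p).re := by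
  obtain ⟨a, ha, hAa⟩ := exists_forall_mul_le_of_posDef hA
  obtain ⟨c, hc, hCc⟩ := exists_forall_mul_le_of_posDef hC
  refine ⟨2 * min a c, by positivity, fun p => ?_⟩
  obtain ⟨x, y, rfl⟩ : ∃ x y : Fin n → ℝ, p = Sum.elim x y :=
    ⟨p ∘ Sum.inl, p ∘ Sum.inr, by ext i; cases i <;> rfl⟩
  have hcx : complexify (Sum.elim x y) = Sum.elim (complexify x) (complexify y) := by
    ext i; cases i <;> rfl
  have hre : (complexify (Sum.elim x y) ⬝ᵥ fullForm A B C *ᵥ complexify (Sum.elim x y)).re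
      = (x - y) ⬝ᵥ A *ᵥ (x - y) + (x + y) ⬝ᵥ C *ᵥ (x + y) := by
    have h1 := congrArg norm (gaussianKernel_eq (B := B) hA hC x y)
    rw [gaussianKernel, ← dotProduct_fullForm_mulVec, Complex.norm_exp, Complex.norm_exp,
      Real.exp_eq_exp, ← hcx] at h1
    simp only [Complex.sub_re, Complex.neg_re, Complex.ofReal_re, Complex.mul_re, Complex.I_re,
      Complex.I_im, Complex.ofReal_im] at h1
    linarith
  rw [hre, sumElim_dotProduct_sumElim]
  have e1 := hAa (x - y)
  have e2 := hCc (x + y)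
  have f1 : min a c * ((x - y) ⬝ᵥ (x - y)) ≤ a * ((x - y) ⬝ᵥ (x - y)) :=
    mul_le_mul_of_nonneg_right (min_le_left _ _)
      (Finset.sum_nonneg fun i _ => mul_self_nonneg _)
  have f2 : min a c * ((x + y) ⬝ᵥ (x + y)) ≤ c * ((x + y) ⬝ᵥ (x + y)) :=
    mul_le_mul_of_nonneg_right (min_le_right _ _)
      (Finset.sum_nonneg fun i _ => mul_self_nonneg _)
  have e3 : (x - y) ⬝ᵥ (x - y) + (x + y) ⬝ᵥ (x + y) = 2 * (x ⬝ᵥ x + y ⬝ᵥ y) := by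
    simp only [dotProduct_add, dotProduct_sub, add_dotProduct, sub_dotProduct]
    ring
  calc 2 * min a c * (x ⬝ᵥ x + y ⬝ᵥ y)
      = min a c * ((x - y) ⬝ᵥ (x - y)) + min a c * ((x + y) ⬝ᵥ (x + y)) := by
        rw [← mul_add, e3]; ring
    _ ≤ _ := by linarith

lemma norm_sq_twistedKernel_le (hA : A.PosDef) (hC : C.PosDef)
    {P : MvPolynomial (Fin n ⊕ Fin n) ℂ} (h : OpPosSemidef (polyGaussianKernel P A B C))
    (z w : Fin n → ℂ) :
    ‖twistedKernel P (crossForm A B C) z w‖ ^ 2 ≤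
      ‖twistedKernel P (crossForm A B C) z z‖ * ‖twistedKernel P (crossForm A B C) w w‖ := by
  obtain ⟨δ, hδ, hQ⟩ := exists_forall_mul_le_re_fullForm (B := B) hA hC
  have hF := gaussDecay_eval_mul_cexp P hδ hQ
  have hd : Differentiable ℂ fun v : Fin n ⊕ Fin n → ℂ =>
      MvPolynomial.eval v P * Complex.exp (-(v ⬝ᵥ fullForm A B C *ᵥ v)) :=
    (differentiable_eval P).mul (differentiable_dotProduct_mulVec _).neg.cexp
  have hker : polyGaussianKernel P A B C = fun x y =>
      (fun v : Fin n ⊕ Fin n → ℂ => MvPolynomial.eval v P *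
        Complex.exp (-(v ⬝ᵥ fullForm A B C *ᵥ v))) (complexify (Sum.elim x y)) := by
    ext x y; exact polyGaussianKernel_eq hA hC P x y
  rw [hker] at h
  -- the factors depending on one variable only are absorbed into the coefficients
  let g : (Fin n → ℂ) → ℂ := fun u => u ⬝ᵥ (diagonalForm A B C).map star *ᵥ u
  have hg : ∀ u, star u ⬝ᵥ diagonalForm A B C *ᵥ star u = star (g u) := by
    intro u
    simp [g, dotProduct, mulVec]
  refine sq_norm_le_of_nonneg (o₂ := twistedKernel P (crossForm A B C) w z) fun s t => ?_
  refine (h.sum_nonneg hF hd ![s * Complex.exp (g z), t * Complex.exp (g w)] ![z, w]).trans_eq ?_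
  have hterm : ∀ (s t : ℂ) (u v : Fin n → ℂ),
      star (s * Complex.exp (g u)) * (t * Complex.exp (g v)) *
        (MvPolynomial.eval (Sum.elim (star u) v) P *
          Complex.exp (-(Sum.elim (star u) v ⬝ᵥ fullForm A B C *ᵥ Sum.elim (star u) v)))
        = star s * t * twistedKernel P (crossForm A B C) u v := by
    intro s t u v
    have he : star (Complex.exp (g u)) = Complex.exp (star (g u)) := by
      simp [← Complex.exp_conj]
    rw [dotProduct_fullForm_mulVec, hg, twistedKernel, star_mul', he]
    have : Complex.exp (-star (g u) - v ⬝ᵥ (diagonalForm A B C).map star *ᵥ v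
        + star u ⬝ᵥ crossForm A B C *ᵥ v) = (Complex.exp (star (g u)))⁻¹ * (Complex.exp (g v))⁻¹ *
          Complex.exp (star u ⬝ᵥ crossForm A B C *ᵥ v) := by
      rw [← Complex.exp_neg, ← Complex.exp_neg, ← Complex.exp_add, ← Complex.exp_add,
        sub_eq_add_neg]
    rw [this]
    have h1 := Complex.exp_ne_zero (star (g u))
    have h2 := Complex.exp_ne_zero (g v)
    field_simp
  simp only [Fin.sum_univ_two, Matrix.cons_val_zero, Matrix.cons_val_one, hterm]
  ring

/-- A nonzero polynomial factor cannot repair positivity: the matrix of the mixed terms is positive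
semidefinite as soon as the operator of `P κ_G` is. -/
theorem posSemidef_crossForm (hA : A.PosDef) (hC : C.PosDef)
    {P : MvPolynomial (Fin n ⊕ Fin n) ℂ} (hP : P ≠ 0)
    (h : OpPosSemidef (polyGaussianKernel P A B C)) : (crossForm A B C).PosSemidef := by
  by_contra hH
  have hherm := isHermitian_crossForm (B := B) hA hC
  rw [posSemidef_iff_dotProduct_mulVec] at hH
  push Not at hH
  obtain ⟨c, hc⟩ := hH hherm
  have him : (star c ⬝ᵥ crossForm A B C *ᵥ c).im = 0 := hherm.im_star_dotProduct_mulVec_self c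
  have hre : (star c ⬝ᵥ crossForm A B C *ᵥ c).re < 0 := by
    by_contra hcon
    exact hc (Complex.le_def.2 ⟨not_lt.1 hcon, him.symm⟩)
  exact hP (eq_zero_of_norm_sq_twistedKernel_le hre (norm_sq_twistedKernel_le hA hC h))

end

/-! ### Positivity of the Gaussian operator -/

section

variable {α ι : Type*} [MeasurableSpace α] [Fintype ι]

lemma norm_sum_star_mul_le (u v : ι → ℂ) :
    ‖∑ i, star (u i) * v i‖ ≤ (∑ i, ‖u i‖ ^ 2 + ∑ i, ‖v i‖ ^ 2) / 2 := by
  rw [← Finset.sum_add_distrib, Finset.sum_div]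
  refine (norm_sum_le _ _).trans (Finset.sum_le_sum fun i _ => ?_)
  rw [norm_mul, norm_star]
  nlinarith [sq_nonneg (‖u i‖ - ‖v i‖)]

/-- Monomials in the features `φ` are integrable against `h`: with `s = ∑ ‖φ i‖²`, a monomial of
degree `m` is at most `√s ^ m ≤ m! exp √s ≤ m! exp ((1 + s) / 2)`. -/
lemma integrable_prod_mul_of_exp {μ : Measure α} {h : α → ℂ} {φ : α → ι → ℂ}
    (hh : AEStronglyMeasurable h μ) (hφ : ∀ i, StronglyMeasurable fun x => φ x i)
    (hint : Integrable (fun x => ‖h x‖ * Real.exp ((∑ i, ‖φ x i‖ ^ 2) / 2)) μ)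
    {m : ℕ} (p : Fin m → ι) : Integrable (fun x => (∏ i, φ x (p i)) * h x) μ := by
  refine (hint.const_mul (m.factorial * Real.exp (1 / 2))).mono' ?_ (ae_of_all _ fun x => ?_)
  · refine AEStronglyMeasurable.mul ?_ hh
    exact (Finset.stronglyMeasurable_fun_prod _ fun i _ => hφ (p i)).aestronglyMeasurable
  · set s := ∑ i, ‖φ x i‖ ^ 2 with hs
    have hs0 : 0 ≤ s := by positivity
    have h1 : ∀ i, ‖φ x i‖ ≤ √s := fun i => by
      refine Real.le_sqrt_of_sq_le ?_
      exact Finset.single_le_sum (f := fun j => ‖φ x j‖ ^ 2) (fun j _ => by positivity)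
        (Finset.mem_univ i)
    have h2 : ‖∏ i, φ x (p i)‖ ≤ √s ^ m := by
      rw [norm_prod]
      refine (Finset.prod_le_prod (fun i _ => norm_nonneg _) fun i _ => h1 (p i)).trans ?_
      simp
    have h3 : √s ^ m ≤ m.factorial * Real.exp (√s) := by
      have := Real.pow_div_factorial_le_exp (√s) (Real.sqrt_nonneg _) m
      rwa [div_le_iff₀' (by positivity)] at this
    have h4 : √s ≤ 1 / 2 + s / 2 := by
      nlinarith [Real.sq_sqrt hs0, sq_nonneg (√s - 1)]
    calc ‖(∏ i, φ x (p i)) * h x‖ = ‖∏ i, φ x (p i)‖ * ‖h x‖ := norm_mul _ _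
      _ ≤ (m.factorial * Real.exp (1 / 2 + s / 2)) * ‖h x‖ := by
        gcongr
        exact h2.trans (h3.trans (by gcongr))
      _ = _ := by rw [Real.exp_add]; ring

/-- The `m`-th power of `∑ φ_i(x)^* φ_i(y)` is again a sum of products `ψ(x)^* ψ(y)`, now over the
monomials `ψ` of degree `m`, so its quadratic form at `h` is a sum of squares `|∫ ψ h|²`. -/
lemma integral_pow_kernel_nonneg {μ : Measure α} [SFinite μ] {h : α → ℂ} {φ : α → ι → ℂ} {m : ℕ}
    (hint : ∀ p : Fin m → ι, Integrable (fun x => (∏ i, φ x (p i)) * h x) μ) :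
    0 ≤ ∫ z : α × α, star (h z.1) * h z.2 *
      ((∑ i, star (φ z.1 i) * φ z.2 i) ^ m / (m.factorial : ℂ)) ∂(μ.prod μ) := by
  set ψ : (Fin m → ι) → α → ℂ := fun p x => (∏ i, φ x (p i)) * h x with hψ
  have hpow : ∀ z : α × α, star (h z.1) * h z.2 *
      ((∑ i, star (φ z.1 i) * φ z.2 i) ^ m / (m.factorial : ℂ))
        = ∑ p : Fin m → ι, (m.factorial : ℂ)⁻¹ * (star (ψ p z.1) * ψ p z.2) := by
    intro z
    rw [Finset.sum_pow', Fintype.piFinset_univ, div_eq_mul_inv, Finset.sum_mul, Finset.mul_sum]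
    refine Finset.sum_congr rfl fun p _ => ?_
    simp only [hψ]
    rw [Finset.prod_mul_distrib, star_mul', star_prod]
    ring
  have hval : ∀ p, ∫ z : α × α, (m.factorial : ℂ)⁻¹ * (star (ψ p z.1) * ψ p z.2) ∂(μ.prod μ) =
      (m.factorial : ℂ)⁻¹ * (star (∫ x, ψ p x ∂μ) * ∫ x, ψ p x ∂μ) := by
    intro p
    rw [integral_const_mul, integral_prod_mul (fun x => star (ψ p x)) (ψ p)]
    congr 2
    exact integral_conj
  have hi : ∀ p, Integrable
      (fun z : α × α => (m.factorial : ℂ)⁻¹ * (star (ψ p z.1) * ψ p z.2)) (μ.prod μ) := by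
    intro p
    have hstar : Integrable (fun x => star (ψ p x)) μ :=
      (hint p).norm.mono' (hint p).aestronglyMeasurable.star
        (ae_of_all _ fun x => (norm_star _).le)
    exact (hstar.mul_prod (hint p)).const_mul _
  simp_rw [hpow]
  rw [integral_finsetSum _ fun p _ => hi p]
  refine Finset.sum_nonneg fun p _ => ?_
  rw [hval]
  refine mul_nonneg ?_ (star_mul_self_nonneg _)
  rw [← Complex.ofReal_natCast, ← Complex.ofReal_inv]
  exact_mod_cast (by positivity : (0 : ℝ) ≤ (m.factorial : ℝ)⁻¹)

/-- The exponential of a kernel `∑ φ_i(x)^* φ_i(y)` of finite rank is positive semidefinite, by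
integrating its power series term by term. -/
lemma integral_exp_kernel_nonneg {μ : Measure α} [SFinite μ] {h : α → ℂ} {φ : α → ι → ℂ}
    (hh : AEStronglyMeasurable h μ) (hφ : ∀ i, StronglyMeasurable fun x => φ x i)
    (hint : Integrable (fun x => ‖h x‖ * Real.exp ((∑ i, ‖φ x i‖ ^ 2) / 2)) μ) :
    0 ≤ ∫ x, ∫ y, star (h x) * h y * Complex.exp (∑ i, star (φ x i) * φ y i) ∂μ ∂μ := by
  obtain ⟨s, hs⟩ : ∃ s : α → ℝ, ∀ x, s x = ∑ i, ‖φ x i‖ ^ 2 := ⟨_, fun _ => rfl⟩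
  obtain ⟨k, hk⟩ : ∃ k : α × α → ℂ, ∀ z, k z = ∑ i, star (φ z.1 i) * φ z.2 i := ⟨_, fun _ => rfl⟩
  obtain ⟨w, hw⟩ : ∃ w : α × α → ℂ, ∀ z, w z = star (h z.1) * h z.2 := ⟨_, fun _ => rfl⟩
  have hs0 : ∀ x, 0 ≤ s x := fun x => by rw [hs]; positivity
  have hkm : StronglyMeasurable k := by
    rw [funext hk]
    refine Finset.stronglyMeasurable_fun_sum _ fun i _ => ?_
    exact (((hφ i).comp_measurable measurable_fst).star).mul
      ((hφ i).comp_measurable measurable_snd)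
  have hwm : AEStronglyMeasurable w (μ.prod μ) := by
    rw [funext hw]
    exact hh.comp_fst.star.mul hh.comp_snd
  have hkle : ∀ z : α × α, ‖k z‖ ≤ (s z.1 + s z.2) / 2 := fun z => by
    rw [hk, hs, hs]; exact norm_sum_star_mul_le _ _
  have hbound : Integrable (fun z => ‖w z‖ * Real.exp ((s z.1 + s z.2) / 2)) (μ.prod μ) := by
    refine (hint.mul_prod hint).congr (ae_of_all _ fun z => ?_)
    simp only [hw, hs, norm_mul, norm_star, add_div, Real.exp_add]
    ring
  have hexpS : ∀ z : α × α, HasSum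
      (fun m : ℕ => ‖w z‖ * (((s z.1 + s z.2) / 2) ^ m / (m.factorial : ℝ)))
      (‖w z‖ * Real.exp ((s z.1 + s z.2) / 2)) := fun z => by
    have h := NormedSpace.expSeries_div_hasSum_exp ((s z.1 + s z.2) / 2)
    rw [← Real.exp_eq_exp_ℝ] at h
    exact h.mul_left _
  have hsum := hasSum_integral_of_dominated_convergence (μ := μ.prod μ)
    (F := fun (m : ℕ) z => w z * (k z ^ m / (m.factorial : ℂ)))
    (f := fun z => w z * Complex.exp (k z))
    (fun (m : ℕ) z => ‖w z‖ * (((s z.1 + s z.2) / 2) ^ m / (m.factorial : ℝ)))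
    (fun m => by
      simp only [div_eq_mul_inv]
      exact hwm.mul ((hkm.pow m).mul stronglyMeasurable_const).aestronglyMeasurable)
    (fun m => ae_of_all _ fun z => by
      rw [norm_mul, norm_div, norm_pow, Complex.norm_natCast]
      gcongr
      exact hkle z)
    (ae_of_all _ fun z => (hexpS z).summable)
    (hbound.congr (ae_of_all _ fun z => (hexpS z).tsum_eq.symm))
    (ae_of_all _ fun z => by
      have h := NormedSpace.expSeries_div_hasSum_exp (k z)
      rw [← Complex.exp_eq_exp_ℂ] at h
      exact h.mul_left _)
  have hI : Integrable (fun z : α × α => w z * Complex.exp (k z)) (μ.prod μ) := by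
    refine hbound.mono'
      (hwm.mul (Complex.continuous_exp.comp_stronglyMeasurable hkm).aestronglyMeasurable)
      (ae_of_all _ fun z => ?_)
    rw [norm_mul, Complex.norm_exp]
    gcongr
    exact (Complex.re_le_norm _).trans (hkle z)
  have hprod := integral_prod _ hI
  simp only [hw, hk] at hprod hsum
  rw [← hprod]
  exact hsum.nonneg fun m =>
    integral_pow_kernel_nonneg fun p => integrable_prod_mul_of_exp hh hφ hint p

end

open scoped MatrixOrder in
lemma _root_.Matrix.PosSemidef.exists_eq_conjTranspose_mul_self {n : ℕ}
    {H : Matrix (Fin n) (Fin n) ℂ} (hH : H.PosSemidef) :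
    ∃ L : Matrix (Fin n) (Fin n) ℂ, H = Lᴴ * L :=
  CStarAlgebra.nonneg_iff_eq_star_mul_self.mp hH.nonneg

variable {n : ℕ} {A B C : Matrix (Fin n) (Fin n) ℝ}

/-- Writing `crossForm = Lᴴ L`, the mixed terms become `∑ φ_i(x)^* φ_i(y)` with `φ x = L x`. -/
theorem opPosSemidef_gaussianKernel (hA : A.PosDef) (hC : C.PosDef)
    (hH : (crossForm A B C).PosSemidef) : OpPosSemidef (gaussianKernel A B C) := by
  intro f hf
  obtain ⟨L, hL⟩ := hH.exists_eq_conjTranspose_mul_self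
  obtain ⟨c, hc, hCc⟩ := exists_forall_mul_le_of_posDef hC
  set φ : (Fin n → ℝ) → Fin n → ℂ := fun x => L *ᵥ complexify x with hφ
  set G : (Fin n → ℝ) → ℂ := fun x =>
    Complex.exp (-(complexify x ⬝ᵥ (diagonalForm A B C).map star *ᵥ complexify x)) with hG
  have hGc : Continuous G := by
    simp only [hG, dotProduct, mulVec]
    fun_prop
  have hφc : ∀ i, Continuous fun x => φ x i := by
    intro i
    simp only [hφ, dotProduct, mulVec]
    fun_prop
  have hcross : ∀ x y : Fin n → ℝ, complexify x ⬝ᵥ crossForm A B C *ᵥ complexify y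
      = ∑ i, star (φ x i) * φ y i := by
    intro x y
    have : star (complexify x) = complexify x := by ext i; simp [complexify]
    rw [hL, ← mulVec_mulVec, dotProduct_mulVec, ← this, ← star_mulVec]
    rfl
  have hker : ∀ x y, gaussianKernel A B C x y
      = star (G x) * G y * Complex.exp (∑ i, star (φ x i) * φ y i) := by
    intro x y
    have hstar : star (G x) =
        Complex.exp (-(complexify x ⬝ᵥ diagonalForm A B C *ᵥ complexify x)) := by
      simp only [hG, Complex.star_def, ← Complex.exp_conj, map_neg]
      simp [dotProduct, mulVec, complexify]
    rw [gaussianKernel_eq hA hC, hcross, hstar, ← Complex.exp_add, ← Complex.exp_add,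
      sub_eq_add_neg]
  have hnorm : ∀ x, ‖G x‖ * Real.exp ((∑ i, ‖φ x i‖ ^ 2) / 2) = Real.exp (-2 * (x ⬝ᵥ C *ᵥ x)) := by
    intro x
    -- on the diagonal the kernel equals `exp (-4 xᵀCx)`, the square of the left-hand side
    have h1 := congrArg norm (hker x x)
    have h2 : ∑ i, star (φ x i) * φ x i = ((∑ i, ‖φ x i‖ ^ 2 : ℝ) : ℂ) := by
      push_cast
      exact Finset.sum_congr rfl fun i _ => Complex.conj_mul' _
    rw [gaussianKernel, h2, norm_mul, norm_mul, norm_star, Complex.norm_exp,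
      Complex.norm_exp (((∑ i, ‖φ x i‖ ^ 2 : ℝ) : ℂ)), Complex.ofReal_re] at h1
    have h3 : (x + x) ⬝ᵥ C *ᵥ (x + x) = 4 * (x ⬝ᵥ C *ᵥ x) := by
      simp only [mulVec_add, dotProduct_add, add_dotProduct]; ring
    rw [h3] at h1
    simp only [sub_self, zero_dotProduct, Complex.ofReal_zero, neg_zero, mul_zero, zero_sub,
      Complex.neg_re, Complex.ofReal_re] at h1
    refine (sq_eq_sq₀ (by positivity) (by positivity)).1 ?_
    rw [mul_pow, ← Real.exp_nat_mul, ← Real.exp_nat_mul]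
    push_cast
    rw [mul_div_cancel₀ _ two_ne_zero, sq, ← h1]
    congr 1
    ring
  have hE : MemLp (fun x : Fin n → ℝ => Real.exp (-2 * (x ⬝ᵥ C *ᵥ x))) 2 volume := by
    have hcont : Continuous fun x : Fin n → ℝ => Real.exp (-2 * (x ⬝ᵥ C *ᵥ x)) := by
      simp only [dotProduct, mulVec]; fun_prop
    rw [memLp_two_iff_integrable_sq_norm hcont.aestronglyMeasurable]
    refine (integrable_exp_neg_dotProduct_self (δ := 4 * c) (by positivity)).mono'
      (by fun_prop) (ae_of_all _ fun x => ?_)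
    rw [norm_pow, norm_norm, Real.norm_eq_abs, Real.abs_exp, ← Real.exp_nat_mul, Real.exp_le_exp]
    have := hCc x
    push_cast
    linarith
  have hint : Integrable fun x => ‖G x * f x‖ * Real.exp ((∑ i, ‖φ x i‖ ^ 2) / 2) := by
    refine (hE.integrable_mul hf.norm).congr (ae_of_all _ fun x => ?_)
    simp only [Pi.mul_apply, ← hnorm, norm_mul]
    ring
  refine (integral_exp_kernel_nonneg (hGc.aestronglyMeasurable.mul hf.aestronglyMeasurable)
    (fun i => (hφc i).stronglyMeasurable) hint).trans_eq ?_
  congr 1; ext x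
  rw [integralOp, ← integral_mul_const]
  congr 1; ext y
  rw [hker, Pi.mul_apply, Pi.mul_apply, star_mul', ← Complex.star_def]
  ring

end PolyGauss

theorem theorem2p1 {n : ℕ} (A B C : Matrix (Fin n) (Fin n) ℝ) (hA : A.PosDef) (hC : C.PosDef)
    (P : MvPolynomial (Fin n ⊕ Fin n) ℂ) (hP : P ≠ 0)
    (hG : ¬ PolyGauss.OpPosSemidef (PolyGauss.gaussianKernel A B C)) :
    ¬ PolyGauss.OpPosSemidef (PolyGauss.polyGaussianKernel P A B C) := fun h =>
  hG (PolyGauss.opPosSemidef_gaussianKernel hA hC (PolyGauss.posSemidef_crossForm hA hC hP h))
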